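/- Let $N\cong\mathbb{Z}^2$ be a lattice, $M=\mathrm{Hom}(N,\mathbb{Z})$ its dual lattice and $N_{\mathbb{Q}}=N\otimes_{\mathbb{Z}}\mathbb{Q}$. A nonzero point $x$ of $N$ (or of $M$) is primitive if the segment joining $\mathbf{0}$ and $x$ contains no other lattice points. For an integer $l\ge 1$, a full-dimensional lattice polygon $P\subseteq N_{\mathbb{Q}}$ is called $l$-reflexive if $\mathbf{0}$ lies in the interior of $P$, every vertex of $P$ is primitive, and every edge $F$ of $P$ has local index $l$, that is, $F=\{x\in P\mid\langle u_F,x\rangle=l\}$ for some primitive $u_F\in M$. The order of a lattice polygon $P$ containing $\mathbf{0}$ in its interior is $$o_P:=\min\{k\in\mathbb{Z}_{>0} : \mathrm{int}(P/k)\cap N=\{\mathbf{0}\}\}.$$ If $P$ is an $l$-reflexive polygon, then $o_P$ is well defined and $o_P\le\frac{l+1}{2}$. Moreover, for every odd integer $l\ge 1$ the polygon $P_l:=\mathrm{conv}\{\pm(0,1),\pm(l,2),\pm(l,1)\}$ (with $N=\mathbb{Z}^2$) is an $l$-reflexive hexagon, and $o_{P_l}=\frac{l+1}{2}$. -/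

import Mathlib

open scoped TensorProduct Pointwise

noncomputable section

namespace LReflexive

variable (N : Type*) [AddCommGroup N]

/-- The rational vector space `N_ℚ = ℚ ⊗ N` of a lattice `N`. -/
abbrev RatSpace : Type _ := ℚ ⊗[ℤ] N

variable {N}

/-- The natural map from `N` to `N_ℚ`, sending `x` to `1 ⊗ x`. -/
def toRat (x : N) : RatSpace N := (1 : ℚ) ⊗ₜ[ℤ] x

variable (N) in
/-- The lattice points of `N_ℚ`. -/
def latticePoints : Set (RatSpace N) := Set.range (toRat (N := N))

/-- The pairing of `u` in the dual lattice `M = Hom(N, ℤ)` with a point of `N_ℚ`. -/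
def pairing (u : Module.Dual ℤ N) : RatSpace N →ₗ[ℚ] ℚ := Module.Dual.baseChange ℚ u

/-- A lattice point is primitive if it is nonzero and the segment joining it to the origin
contains no other lattice points. It is used both for `N` and for its dual lattice. -/
def IsPrimitive (x : N) : Prop :=
  x ≠ 0 ∧ ∀ y : N, toRat y ∈ segment ℚ (0 : RatSpace N) (toRat x) → y = 0 ∨ y = x

/-- The topological interior of a subset of `N_ℚ`, for the vector space topology coming from `ℚ`
(the product topology in any coordinates). -/
def interiorQ (P : Set (RatSpace N)) : Set (RatSpace N) :=
  @interior (RatSpace N) (moduleTopology ℚ (RatSpace N)) P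

/-- The vertices of a polytope. -/
def vertices (P : Set (RatSpace N)) : Set (RatSpace N) := P.extremePoints ℚ

/-- A full-dimensional polytope all of whose vertices are lattice points. -/
structure IsLatticePolytope (P : Set (RatSpace N)) : Prop where
  polytope : ∃ S : Finset (RatSpace N), P = convexHull ℚ (S : Set (RatSpace N))
  fullDim : affineSpan ℚ P = ⊤
  vertices_subset : vertices P ⊆ latticePoints N

/-- A facet: a nonempty face of codimension one, a face being the set of points of `P` at which
some linear form attains its maximum over `P`. -/
structure IsFacet (P F : Set (RatSpace N)) : Prop where
  nonempty : F.Nonempty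
  face : ∃ f : RatSpace N →ₗ[ℚ] ℚ, F = {x ∈ P | ∀ y ∈ P, f y ≤ f x}
  codim_one : Module.finrank ℚ (vectorSpan ℚ F) + 1 = Module.finrank ℚ (RatSpace N)

/-- The facet `F` of `P` has local index `k`: for a primitive point `u` of the dual lattice
(the primitive outer normal), `F` is cut out of `P` by `⟨u, x⟩ = k`, where `k > 0`. -/
def HasLocalIndex (P F : Set (RatSpace N)) (k : ℕ) : Prop :=
  0 < k ∧ ∃ u : Module.Dual ℤ N, IsPrimitive u ∧ F = {x ∈ P | pairing u x = (k : ℚ)}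

/-- `P` is an `l`-reflexive polytope. -/
structure IsReflexive (l : ℕ) (P : Set (RatSpace N)) : Prop where
  index_pos : 0 < l
  latticePolytope : IsLatticePolytope P
  zero_mem_interior : (0 : RatSpace N) ∈ interiorQ P
  vertices_primitive : ∀ x : N, toRat x ∈ vertices P → IsPrimitive x
  localIndex : ∀ F : Set (RatSpace N), IsFacet P F → HasLocalIndex P F l

/-- The positive integers `k` such that the origin is the only lattice point in the interior
of `P / k`. -/
def orderSet (P : Set (RatSpace N)) : Set ℕ :=
  {k | 0 < k ∧ interiorQ ((k : ℚ)⁻¹ • P) ∩ latticePoints N = {0}}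

/-- The order `o_P`: the least element of `orderSet P` (and `0` if that set is empty). -/
def order (P : Set (RatSpace N)) : ℕ := sInf (orderSet P)

/-- The hexagon `P_l` with vertices `±(0,1), ±(l,2), ±(l,1)` in the plane of the lattice `ℤ²`. -/
def hexagon (l : ℕ) : Set (RatSpace (Fin 2 → ℤ)) :=
  convexHull ℚ (toRat '' ({![0, 1], ![0, -1], ![(l : ℤ), 2], ![-(l : ℤ), -2],
    ![(l : ℤ), 1], ![-(l : ℤ), -1]} : Set (Fin 2 → ℤ)))

end LReflexive

end

/-!
Two adjacent edges of an `l`-reflexive polygon share a primitive vertex `n`, at which both primitive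
normals take the value `l`; hence both vanish modulo `l` exactly on `ℤ n + l N`. Going round the
boundary, all edge normals vanish modulo `l` on the same sublattice, and this sublattice contains
all vertices.

If some lattice point `x ≠ 0` had height at most `1` over every edge, then for `l ≠ 1` an edge over
which it has height `1` would have both neighbouring edges at negative height over `x`: height `0`
is excluded by the congruence, height `1` by the primitivity of the common vertex. These two
neighbours confine every vertex `y` with `u y < 0`, where `u` is the normal of the first edge, to
the line through `x`, so that `y = (u y) x` with `l ∣ u y`, contradicting the primitivity of `y`.
Hence some edge normal takes a value at least `2` at `x`, which puts `k x` outside the interior of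
`P` as soon as `2 k ≥ l`. For the hexagon, `k (1, 0)` is interior as long as `2 k < l`.
-/

namespace LReflexive

section ConvexGeometry

variable {𝕜 V : Type*} [Field 𝕜] [LinearOrder 𝕜] [IsStrictOrderedRing 𝕜] [AddCommGroup V]
  [Module 𝕜 V]

lemma le_of_mem_convexHull {S : Set V} {f : V →ₗ[𝕜] 𝕜} {c : 𝕜} (h : ∀ s ∈ S, f s ≤ c) {y : V}
    (hy : y ∈ convexHull 𝕜 S) : f y ≤ c :=
  convexHull_min h (convex_halfSpace_le f.isLinear c) hy

lemma add_pos_of_smul_add_smul_ne_zero {a b : V} {s t : 𝕜} (hs : 0 ≤ s) (ht : 0 ≤ t)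
    (h : s • a + t • b ≠ 0) : 0 < s + t := by
  refine (add_nonneg hs ht).lt_of_ne fun hst => h ?_
  obtain ⟨rfl, rfl⟩ := (add_eq_zero_iff_of_nonneg hs ht).1 hst.symm
  simp

lemma smul_add_smul_mem_of_zero_mem {C : Set V} (hC : Convex 𝕜 C) (h0 : (0 : V) ∈ C) {a b : V}
    (ha : a ∈ C) (hb : b ∈ C) {s t : 𝕜} (hs : 0 ≤ s) (ht : 0 ≤ t) (hst : s + t ≤ 1) :
    s • a + t • b ∈ C := by
  rcases (add_nonneg hs ht).eq_or_lt with h | h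
  · obtain ⟨rfl, rfl⟩ := (add_eq_zero_iff_of_nonneg hs ht).1 h.symm
    simpa using h0
  · have hmem := hC ha hb (div_nonneg hs h.le) (div_nonneg ht h.le) (by field_simp)
    simpa [smul_smul, mul_div_cancel₀ _ h.ne'] using
      hC.smul_mem_of_zero_mem h0 hmem ⟨h.le, hst⟩

lemma smul_add_smul_mem_of_abs_sub_le_one {C : Set V} (hC : Convex 𝕜 C) {a b : V} (ha : a ∈ C)
    (ha' : -a ∈ C) (hb : b ∈ C) (hb' : -b ∈ C) (hab : a + b ∈ C) (hab' : -(a + b) ∈ C) {s t : 𝕜}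
    (hs : |s| ≤ 1) (ht : |t| ≤ 1) (hst : |s - t| ≤ 1) : s • a + t • b ∈ C := by
  have h0 : (0 : V) ∈ C := by
    have := hC.midpoint_mem ha ha'
    rwa [midpoint_self_neg] at this
  wlog ht0 : 0 ≤ t generalizing a b s t
  · have := this (a := -a) (b := -b) (s := -s) (t := -t) ha' (by rwa [neg_neg]) hb'
      (by rwa [neg_neg]) (by rwa [← neg_add]) (by rwa [← neg_add, neg_neg]) (by rwa [abs_neg])
      (by rwa [abs_neg]) (by rwa [neg_sub_neg, abs_sub_comm]) (by linarith)
    simpa using this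
  rw [abs_le] at hs ht hst
  rcases le_total s 0 with hs0 | hs0
  · rw [show s • a + t • b = (-s) • (-a) + t • b by module]
    exact smul_add_smul_mem_of_zero_mem hC h0 ha' hb (by linarith) ht0 (by linarith)
  rcases le_total s t with hle | hle
  · rw [show s • a + t • b = s • (a + b) + (t - s) • b by module]
    exact smul_add_smul_mem_of_zero_mem hC h0 hab hb hs0 (by linarith) (by linarith)
  · rw [show s • a + t • b = t • (a + b) + (s - t) • a by module]
    exact smul_add_smul_mem_of_zero_mem hC h0 hab ha ht0 (by linarith) (by linarith)

lemma le_one_of_smul_mem_of_mem_extremePoints {C : Set V} (h0 : (0 : V) ∈ C) {x : V}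
    (hx : x ∈ C.extremePoints 𝕜) (hx0 : x ≠ 0) {c : 𝕜} (hc : c • x ∈ C) : c ≤ 1 := by
  by_contra! h1
  have hc0 : 0 < c := by linarith
  refine hx0 (hx.2 h0 hc ⟨1 - c⁻¹, c⁻¹, ?_, by positivity, by ring, ?_⟩).symm
  · simpa using inv_lt_one_of_one_lt₀ h1
  · rw [smul_zero, zero_add, inv_smul_smul₀ hc0.ne']

lemma nonneg_of_mem_extremePoints {C : Set V} {x y : V} (hx : x ∈ C.extremePoints 𝕜) (hy : y ∈ C)
    (hxy : x ≠ y) {a b : 𝕜} (hab : a + b = 1) (hmem : a • x + b • y ∈ C) : 0 ≤ b := by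
  by_contra! hb
  obtain rfl : a = 1 - b := by linarith
  have ha : 0 < 1 - b := by linarith
  have heq : (1 - b) • x + b • y = x := by
    refine hx.2 hmem hy ⟨(1 - b)⁻¹, -b / (1 - b), by positivity, div_pos (by linarith) ha,
      by field_simp; ring, ?_⟩
    rw [smul_add, inv_smul_smul₀ ha.ne', smul_smul, add_assoc, ← add_smul, inv_mul_eq_div,
      ← add_div, add_neg_cancel, zero_div, zero_smul, add_zero]
  have hsub : b • (y - x) = 0 := by linear_combination (norm := module) heq
  exact hxy (sub_eq_zero.1 ((smul_eq_zero.1 hsub).resolve_left hb.ne)).symm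

lemma mem_extremePoints_of_forall_le {C : Set V} {f g : V →ₗ[𝕜] 𝕜} {w : V} (hw : w ∈ C)
    (hf : ∀ y ∈ C, f y ≤ f w) (hg : ∀ y ∈ C, g y ≤ g w)
    (hfg : ∀ y, f y = f w → g y = g w → y = w) : w ∈ C.extremePoints 𝕜 := by
  have apply_eq : ∀ h : V →ₗ[𝕜] 𝕜, (∀ y ∈ C, h y ≤ h w) → ∀ y ∈ C, ∀ z ∈ C,
      w ∈ openSegment 𝕜 y z → h y = h w := by
    rintro h hh y hy z hz ⟨a, b, ha, hb, hab, hyz⟩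
    have hw' : a * h y + b * h z = (a + b) * h w := by
      simpa [hab] using congrArg h hyz
    nlinarith [hh y hy, hh z hz]
  exact ⟨hw, fun y hy z hz hyz => hfg y (apply_eq f hf y hy z hz hyz) (apply_eq g hg y hy z hz hyz)⟩

lemma mem_convexHull_sdiff_or_mem_extremePoints {S : Set V} {s : V} (hs : s ∈ S) :
    s ∈ convexHull 𝕜 (S \ {s}) ∨ s ∈ (convexHull 𝕜 S).extremePoints 𝕜 := by
  refine or_iff_not_imp_left.2 fun hsC => ⟨subset_convexHull 𝕜 S hs, fun y hy z hz hyz => ?_⟩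
  obtain hemp | hne := (S \ {s}).eq_empty_or_nonempty
  · have hS : S = {s} := (Set.sdiff_eq_empty.1 hemp).antisymm (Set.singleton_subset_iff.2 hs)
    simpa [hS] using hy
  have exists_dilation : ∀ p ∈ convexHull 𝕜 S, ∃ t ∈ convexHull 𝕜 (S \ {s}), ∃ θ : 𝕜, 0 ≤ θ ∧
      p = s + θ • (t - s) := by
    intro p hp
    rw [← Set.insert_sdiff_self_of_mem hs, convexHull_insert hne, mem_convexJoin] at hp
    obtain ⟨_, rfl, t, ht, hpt⟩ := hp
    rw [segment_eq_image'] at hpt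
    obtain ⟨θ, hθ, rfl⟩ := hpt
    exact ⟨t, ht, θ, hθ.1, rfl⟩
  obtain ⟨t, ht, θ, hθ, rfl⟩ := exists_dilation y hy
  obtain ⟨r, hr, η, hη, rfl⟩ := exists_dilation z hz
  obtain ⟨a, b, ha, hb, hab, hsum⟩ := hyz
  rcases hθ.eq_or_lt with rfl | hθ
  · simp
  refine absurd ?_ hsC
  have hpos : 0 < a * θ + b * η := by positivity
  have hs_eq : s = (a * θ / (a * θ + b * η)) • t + (b * η / (a * θ + b * η)) • r := by
    refine smul_right_injective V hpos.ne' ?_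
    simp only [smul_add, smul_smul, mul_div_cancel₀ _ hpos.ne']
    obtain rfl := eq_sub_of_add_eq hab
    linear_combination (norm := module) (-1 : 𝕜) • hsum
  have hmem := convex_convexHull 𝕜 (S \ {s}) ht hr (a := a * θ / (a * θ + b * η))
    (b := b * η / (a * θ + b * η)) (by positivity) (by positivity)
    (by rw [← add_div, div_self hpos.ne'])
  rwa [← hs_eq] at hmem

lemma convexHull_extremePoints_convexHull {S : Set V} (hS : S.Finite) :
    convexHull 𝕜 ((convexHull 𝕜 S).extremePoints 𝕜) = convexHull 𝕜 S := by
  induction hn : S.ncard generalizing S with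
  | zero => simp [(Set.ncard_eq_zero hS).1 hn]
  | succ n ih =>
    by_cases hred : ∃ s ∈ S, s ∈ convexHull 𝕜 (S \ {s})
    · obtain ⟨s, hs, hsC⟩ := hred
      have hsdiff : convexHull 𝕜 (S \ {s}) = convexHull 𝕜 S :=
        (convexHull_mono Set.sdiff_subset).antisymm <| convexHull_min
          (fun t ht => (eq_or_ne t s).elim (fun h => h ▸ hsC)
            fun h => subset_convexHull 𝕜 _ ⟨ht, h⟩) (convex_convexHull 𝕜 _)
      rw [← hsdiff]
      exact ih (hS.subset Set.sdiff_subset) (by rw [Set.ncard_sdiff_singleton_of_mem hs, hn]; rfl)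
    · push Not at hred
      refine (convexHull_min extremePoints_subset (convex_convexHull 𝕜 S)).antisymm
        (convexHull_mono fun s hs => ?_)
      exact (mem_convexHull_sdiff_or_mem_extremePoints hs).resolve_left (hred s hs)

lemma exists_pos_forall_add_mul_le {α : Type*} {S : Set α} (hS : S.Finite) {f h : α → 𝕜} {c : 𝕜}
    (hf : ∀ s ∈ S, f s ≤ c) (hfh : ∀ s ∈ S, f s = c → h s ≤ 0) (hh : ∃ s ∈ S, 0 < h s) :
    ∃ t, 0 < t ∧ (∀ s ∈ S, f s + t * h s ≤ c) ∧ ∃ s ∈ S, 0 < h s ∧ f s + t * h s = c := by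
  obtain ⟨m, ⟨hmS, hm⟩, hmin⟩ := Set.exists_min_image {s ∈ S | 0 < h s}
    (fun s => (c - f s) / h s) (hS.subset (Set.sep_subset _ _)) hh
  have hlt : f m < c := (hf m hmS).lt_of_ne fun heq => (hfh m hmS heq).not_gt hm
  have htpos : 0 < (c - f m) / h m := div_pos (sub_pos.2 hlt) hm
  refine ⟨(c - f m) / h m, htpos, fun s hs => ?_, m, hmS, hm, ?_⟩
  · rcases lt_or_ge 0 (h s) with hpos | hneg
    · linarith [(le_div_iff₀ hpos).1 (hmin s ⟨hs, hpos⟩)]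
    · linarith [hf s hs, mul_nonpos_of_nonneg_of_nonpos htpos.le hneg]
  · rw [div_mul_cancel₀ _ hm.ne', add_sub_cancel]

end ConvexGeometry

section LinearForms

variable {K V : Type*} [Field K] [AddCommGroup V] [Module K V] {f : V →ₗ[K] K} {c : K} {w z : V}

lemma linearIndependent_pair_of_apply_eq (hc : c ≠ 0) (hw : f w = c) (hz : f z = c)
    (hwz : w ≠ z) : LinearIndependent K ![w, z] := by
  refine LinearIndependent.pair_iff.2 fun a b hab => ?_
  have hsum : (a + b) * c = 0 := by simpa [hw, hz, add_mul] using congrArg f hab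
  obtain rfl : b = -a := by
    linear_combination (mul_eq_zero.1 hsum).resolve_right hc
  have ha : a • (w - z) = 0 := by linear_combination (norm := module) hab
  have ha0 : a = 0 := (smul_eq_zero.1 ha).resolve_right (sub_ne_zero.2 hwz)
  simp [ha0]

lemma exists_eq_smul_add_smul (hV : Module.finrank K V = 2) (hc : c ≠ 0) (hw : f w = c)
    (hz : f z = c) (hwz : w ≠ z) (y : V) : ∃ a b : K, y = a • w + b • z := by
  have hspan := (linearIndependent_pair_of_apply_eq hc hw hz hwz).span_eq_top_of_card_eq_finrank
    (by simp [hV])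
  have hy : y ∈ Submodule.span K (Set.range ![w, z]) := hspan ▸ Submodule.mem_top
  simp only [Matrix.range_cons, Matrix.range_empty, Set.union_empty, Set.singleton_union,
    Submodule.mem_span_pair] at hy
  obtain ⟨a, b, rfl⟩ := hy
  exact ⟨a, b, rfl⟩

lemma eq_of_apply_eq_apply_eq (hV : Module.finrank K V = 2) (hc : c ≠ 0) (hw : f w = c)
    (hz : f z = c) (hwz : w ≠ z) {g h : V →ₗ[K] K} (hgw : g w = h w) (hgz : g z = h z) :
    g = h := by
  refine LinearMap.ext fun y => ?_
  obtain ⟨a, b, rfl⟩ := exists_eq_smul_add_smul hV hc hw hz hwz y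
  simp only [map_add, map_smul, hgw, hgz]

lemma exists_ne_zero_apply_eq_zero (hV : 1 < Module.finrank K V) (w : V) :
    ∃ h : V →ₗ[K] K, h ≠ 0 ∧ h w = 0 := by
  have hlt : Submodule.span K {w} < ⊤ := by
    refine lt_top_iff_ne_top.2 fun htop => hV.not_ge ?_
    rw [← finrank_top K V, ← htop]
    simpa using finrank_span_le_card (R := K) ({w} : Set V)
  obtain ⟨h, hh, hle⟩ := Submodule.exists_le_ker_of_lt_top _ hlt
  exact ⟨h, hh, LinearMap.mem_ker.1 (hle (Submodule.mem_span_singleton_self w))⟩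

lemma finrank_vectorSpan_eq_one (hV : Module.finrank K V = 2) {F : Set V} (hf : f ≠ 0)
    (hF : ∀ y ∈ F, f y = c) (hw : w ∈ F) (hz : z ∈ F) (hwz : w ≠ z) :
    Module.finrank K (vectorSpan K F) = 1 := by
  have : FiniteDimensional K V := Module.finite_of_finrank_pos (by omega)
  have hker : vectorSpan K F ≤ LinearMap.ker f := by
    refine Submodule.span_le.2 ?_
    rintro _ ⟨y, hy, y', hy', rfl⟩
    simp [hF y hy, hF y' hy']
  have hle := Submodule.finrank_mono hker
  have hrank := f.finrank_range_add_finrank_ker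
  rw [LinearMap.range_eq_top.2 (LinearMap.surjective hf), finrank_top, Module.finrank_self] at hrank
  have hne : vectorSpan K F ≠ ⊥ := fun hbot => hwz <| by
    have := vsub_mem_vectorSpan K hw hz
    rwa [hbot, Submodule.mem_bot, vsub_eq_zero_iff_eq] at this
  have := Submodule.one_le_finrank_iff.2 hne
  omega

end LinearForms

section Lattice

variable {N : Type*} [AddCommGroup N]

@[simp]
lemma toRat_add (x y : N) : toRat (x + y) = toRat x + toRat y := TensorProduct.tmul_add _ _ _

@[simp]
lemma toRat_neg (x : N) : toRat (-x) = -toRat x := TensorProduct.tmul_neg _ _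

@[simp]
lemma toRat_zero : toRat (0 : N) = 0 := TensorProduct.tmul_zero _ _

@[simp]
lemma toRat_zsmul (c : ℤ) (x : N) : toRat (c • x) = (c : ℚ) • toRat x := by
  rw [toRat, toRat, ← TensorProduct.smul_tmul, TensorProduct.smul_tmul', zsmul_eq_mul, smul_eq_mul]

@[simp]
lemma pairing_toRat (u : Module.Dual ℤ N) (x : N) : pairing u (toRat x) = u x := by
  simp [pairing, toRat]

variable [Module.Free ℤ N]

lemma toRat_injective : Function.Injective (toRat (N := N)) :=
  Module.Flat.tensorProduct_mk_injective (R := ℤ) (S := ℚ) (M := N)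

lemma IsPrimitive.isUnit_of_eq_zsmul {x y : N} (hx : IsPrimitive x) {d : ℤ} (h : x = d • y) :
    IsUnit d := by
  obtain ⟨hx0, hseg⟩ := hx
  wlog hd : 0 < d generalizing d y
  · have hd0 : d ≠ 0 := by
      rintro rfl
      simp [h] at hx0
    simpa using this (d := -d) (y := -y) (by simpa using h) (by omega)
  have hdq : (1 : ℚ) ≤ d := by exact_mod_cast hd
  have hy : toRat y ∈ segment ℚ (0 : RatSpace N) (toRat x) := by
    rw [segment_eq_image']
    refine ⟨(d : ℚ)⁻¹, ⟨by positivity, inv_le_one_of_one_le₀ hdq⟩, ?_⟩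
    simp [h, inv_smul_smul₀ (by positivity : (d : ℚ) ≠ 0)]
  rcases hseg y hy with rfl | rfl
  · simp [h] at hx0
  · have hd1 : (d - 1) • y = 0 := by rw [sub_smul, one_smul, ← h, sub_self]
    rw [sub_eq_zero.1 ((smul_eq_zero.1 hd1).resolve_right hx0)]
    exact isUnit_one

lemma isPrimitive_of_apply_eq_one {x : N} (u : Module.Dual ℤ N) (h : u x = 1) :
    IsPrimitive x := by
  refine ⟨by rintro rfl; simp at h, fun y hy => ?_⟩
  rw [segment_eq_image'] at hy
  obtain ⟨t, ⟨ht0, ht1⟩, hty⟩ := hy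
  simp only [sub_zero, zero_add] at hty
  have ht : t = u y := by simpa [h] using congrArg (pairing u) hty
  have hyx : y = u y • x := toRat_injective <| by rw [toRat_zsmul, ← ht, hty]
  rw [ht] at ht0 ht1
  norm_cast at ht0 ht1
  obtain h0 | h1 : u y = 0 ∨ u y = 1 := by omega
  · left
    rw [hyx, h0, zero_smul]
  · right
    rw [hyx, h1, one_smul]

variable [Module.Finite ℤ N]

lemma IsPrimitive.exists_dual_apply_eq_one {x : N} (hx : IsPrimitive x) :
    ∃ f : Module.Dual ℤ N, f x = 1 := by
  obtain ⟨d, hd⟩ := (IsPrincipalIdealRing.principal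
    (LinearMap.range (Module.Dual.eval ℤ N x))).principal
  have hdvd : ∀ f : Module.Dual ℤ N, d ∣ f x := fun f => by
    rw [← Ideal.mem_span_singleton, Ideal.span, ← hd]
    exact ⟨f, rfl⟩
  have hunit : IsUnit d := by
    let b := Module.Free.chooseBasis ℤ N
    choose q hq using fun i => hdvd (b.coord i)
    refine hx.isUnit_of_eq_zsmul (y := ∑ i, q i • b i) ?_
    simp_rw [Finset.smul_sum, smul_smul, ← hq]
    exact (b.sum_repr x).symm
  have hmem : (1 : ℤ) ∈ LinearMap.range (Module.Dual.eval ℤ N x) := by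
    rw [hd, ← Ideal.span, Ideal.span_singleton_eq_top.2 hunit]
    trivial
  exact hmem

lemma IsPrimitive.exists_apply_eq_one {u : Module.Dual ℤ N} (hu : IsPrimitive u) :
    ∃ x, u x = 1 := by
  obtain ⟨f, hf⟩ := hu.exists_dual_apply_eq_one
  exact ⟨(Module.evalEquiv ℤ N).symm f, by rw [Module.apply_evalEquiv_symm_apply, hf]⟩

lemma IsPrimitive.exists_eq_zsmul_add_zsmul (hN : Module.finrank ℤ N = 2) {x : N}
    (hx : IsPrimitive x) : ∃ e : N, ∀ y, ∃ c d : ℤ, y = c • x + d • e := by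
  obtain ⟨f, hf⟩ := hx.exists_dual_apply_eq_one
  let b : Module.Basis (Fin 2) ℤ N := Module.finBasisOfFinrankEq ℤ N hN
  have hrepr : ∀ y, y = b.repr y 0 • b 0 + b.repr y 1 • b 1 := fun y => by
    rw [← Fin.sum_univ_two fun i => b.repr y i • b i, b.sum_repr]
  have hrepr_apply : ∀ y, f y = b.repr y 0 * f (b 0) + b.repr y 1 * f (b 1) := fun y => by
    conv_lhs => rw [hrepr y]
    simp
  refine ⟨f (b 0) • b 1 - f (b 1) • b 0, fun y =>
    ⟨f y, b.repr x 0 * b.repr y 1 - b.repr x 1 * b.repr y 0, ?_⟩⟩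
  rw [hrepr_apply] at hf
  rw [hrepr_apply]
  linear_combination (norm := module) hrepr y
    - (b.repr y 0 * f (b 0) + b.repr y 1 * f (b 1)) • hrepr x
    - hf • (b.repr y 0 • b 0 + b.repr y 1 • b 1)

lemma IsPrimitive.dvd_apply_iff_dvd_apply (hN : Module.finrank ℤ N = 2) {x : N}
    (hx : IsPrimitive x) {u v : Module.Dual ℤ N} (hu : IsPrimitive u) (hv : IsPrimitive v) {l : ℤ}
    (hux : l ∣ u x) (hvx : l ∣ v x) (y : N) : l ∣ u y ↔ l ∣ v y := by
  obtain ⟨e, he⟩ := hx.exists_eq_zsmul_add_zsmul hN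
  obtain ⟨c, d, rfl⟩ := he y
  have dvd_iff : ∀ w : Module.Dual ℤ N, IsPrimitive w → l ∣ w x →
      (l ∣ w (c • x + d • e) ↔ l ∣ d) := by
    intro w hw hwx
    obtain ⟨z, hz⟩ := hw.exists_apply_eq_one
    obtain ⟨a, b, rfl⟩ := he z
    simp only [map_add, map_smul, smul_eq_mul] at hz ⊢
    obtain ⟨k, hk⟩ := hwx
    have hcop : IsCoprime l (w e) := ⟨a * k, b, by rw [← hz, hk]; ring⟩
    rw [dvd_add_right (hk ▸ (dvd_mul_right l k).mul_left c)]
    exact ⟨hcop.dvd_of_dvd_mul_right, fun h => h.mul_right _⟩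
  rw [dvd_iff u hu hux, dvd_iff v hv hvx]

end Lattice

section Interior

variable {N : Type*} [AddCommGroup N] {P : Set (RatSpace N)} {x : RatSpace N}

lemma exists_pos_add_smul_mem_of_mem_interiorQ (hx : x ∈ interiorQ P) (d : RatSpace N) :
    ∃ t : ℚ, 0 < t ∧ x + t • d ∈ P := by
  let : TopologicalSpace (RatSpace N) := moduleTopology ℚ (RatSpace N)
  have : IsModuleTopology ℚ (RatSpace N) := ⟨rfl⟩
  have := IsModuleTopology.toContinuousSMul ℚ (RatSpace N)
  have := IsModuleTopology.toContinuousAdd ℚ (RatSpace N)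
  have hcont : Continuous fun t : ℚ => x + t • d := by fun_prop
  have hnhds : P ∈ nhds (x + (0 : ℚ) • d) := by
    rw [zero_smul, add_zero]
    exact mem_interior_iff_mem_nhds.1 hx
  have hP : ∀ᶠ t : ℚ in nhdsWithin 0 (Set.Ioi 0), x + t • d ∈ P :=
    nhdsWithin_le_nhds (hcont.continuousAt.preimage_mem_nhds hnhds)
  exact (Filter.Eventually.and (eventually_mem_nhdsWithin (s := Set.Ioi 0)) hP).exists

lemma interiorQ_smul {c : ℚ} (hc : c ≠ 0) : interiorQ (c • P) = c • interiorQ P := by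
  let : TopologicalSpace (RatSpace N) := moduleTopology ℚ (RatSpace N)
  have : IsModuleTopology ℚ (RatSpace N) := ⟨rfl⟩
  have := IsModuleTopology.toContinuousSMul ℚ (RatSpace N)
  exact interior_smul₀ hc P

lemma interiorQ_subset : interiorQ P ⊆ P :=
  @interior_subset _ (moduleTopology ℚ (RatSpace N)) P

lemma lt_of_mem_interiorQ (hx : x ∈ interiorQ P) {f : RatSpace N →ₗ[ℚ] ℚ} (hf : f ≠ 0) {c : ℚ}
    (hc : ∀ y ∈ P, f y ≤ c) : f x < c := by
  obtain ⟨d, hd⟩ := LinearMap.surjective hf 1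
  obtain ⟨t, ht, hmem⟩ := exists_pos_add_smul_mem_of_mem_interiorQ hx d
  have hle := hc _ hmem
  rw [map_add, map_smul, hd, smul_eq_mul, mul_one] at hle
  linarith

lemma vectorSpan_eq_top_of_mem_interiorQ (hx : x ∈ interiorQ P) : vectorSpan ℚ P = ⊤ := by
  refine eq_top_iff.2 fun d _ => ?_
  obtain ⟨t, ht, hmem⟩ := exists_pos_add_smul_mem_of_mem_interiorQ hx d
  have htd := vsub_mem_vectorSpan ℚ hmem (interiorQ_subset hx)
  rw [vsub_eq_sub, add_sub_cancel_left] at htd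
  exact (Submodule.smul_mem_iff _ ht.ne').1 htd

lemma mem_interiorQ_of_forall_pairing_lt {U : Set (Module.Dual ℤ N)} (hU : U.Finite) {c : ℚ}
    (hx : ∀ u ∈ U, pairing u x < c) : x ∈ interiorQ {y | ∀ u ∈ U, pairing u y ≤ c} := by
  let : TopologicalSpace (RatSpace N) := moduleTopology ℚ (RatSpace N)
  have : IsModuleTopology ℚ (RatSpace N) := ⟨rfl⟩
  have hopen : IsOpen (⋂ u ∈ U, {y | pairing u y < c}) := hU.isOpen_biInter fun u _ =>
    isOpen_lt (IsModuleTopology.continuous_of_linearMap (pairing u)) continuous_const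
  exact interior_maximal (fun y hy u hu => (Set.mem_iInter₂.1 hy u hu).le) hopen
    (Set.mem_iInter₂.2 hx)

end Interior

section Facets

variable {N : Type*} [AddCommGroup N]

lemma IsFacet.exists_eq_sep {P F : Set (RatSpace N)} (hF : IsFacet P F) :
    ∃ (f : RatSpace N →ₗ[ℚ] ℚ) (c : ℚ), (∀ y ∈ P, f y ≤ c) ∧ F = {y ∈ P | f y = c} := by
  obtain ⟨f, rfl⟩ := hF.face
  obtain ⟨x, hx, hmax⟩ := hF.nonempty
  refine ⟨f, f x, hmax, Set.ext fun y => and_congr_right fun hy => ⟨fun h => ?_, fun h => ?_⟩⟩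
  · exact (hmax y hy).antisymm (h x hx)
  · exact fun z hz => h ▸ hmax z hz

variable [Module.Free ℤ N] (hN : Module.finrank ℤ N = 2)

include hN

lemma finrank_ratSpace_eq_two : Module.finrank ℚ (RatSpace N) = 2 := by
  rw [Module.finrank_baseChange, hN]

lemma isFacet_sep_eq {P : Set (RatSpace N)} {f : RatSpace N →ₗ[ℚ] ℚ} {c : ℚ} (hc : c ≠ 0)
    (hf : ∀ y ∈ P, f y ≤ c) {w z : RatSpace N} (hw : w ∈ P) (hz : z ∈ P) (hfw : f w = c)
    (hfz : f z = c) (hwz : w ≠ z) : IsFacet P {y ∈ P | f y = c} := by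
  have hf0 : f ≠ 0 := by
    rintro rfl
    exact hc hfw.symm
  refine ⟨⟨w, hw, hfw⟩, ⟨f, Set.ext fun x => and_congr_right fun hx => ⟨fun h => ?_, fun h => ?_⟩⟩,
    ?_⟩
  · exact fun y hy => h ▸ hf y hy
  · exact (hf x hx).antisymm (hfw ▸ h w hw)
  · rw [finrank_ratSpace_eq_two hN, finrank_vectorSpan_eq_one (finrank_ratSpace_eq_two hN) hf0
      (F := {y ∈ P | f y = c}) (fun y hy => hy.2) ⟨hw, hfw⟩ ⟨hz, hfz⟩ hwz]

lemma IsFacet.nontrivial {P F : Set (RatSpace N)} (hF : IsFacet P F) : F.Nontrivial := by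
  refine Set.not_subsingleton_iff.1 fun hsub => ?_
  have hdim := hF.codim_one
  rw [vectorSpan_of_subsingleton ℚ hsub, finrank_bot, finrank_ratSpace_eq_two hN] at hdim
  omega

lemma hasLocalIndex_of_isFacet {U : Set (Module.Dual ℤ N)} (hU : U.Finite)
    (hprim : ∀ u ∈ U, IsPrimitive u) {l : ℕ} (hl : 0 < l) {P F : Set (RatSpace N)}
    (hP : P = {y | ∀ u ∈ U, pairing u y ≤ l}) (hF : IsFacet P F) : HasLocalIndex P F l := by
  have hlq : (0 : ℚ) < l := by exact_mod_cast hl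
  obtain ⟨w, hw, z, hz, hwz⟩ := hF.nontrivial hN
  have hdim := hF.codim_one
  obtain ⟨f, c, hf, rfl⟩ := hF.exists_eq_sep
  have mem_interior : ∀ y, (∀ u ∈ U, pairing u y < l) → y ∈ interiorQ P :=
    fun y hy => hP ▸ mem_interiorQ_of_forall_pairing_lt hU hy
  have hle : ∀ y ∈ P, ∀ u ∈ U, pairing u y ≤ l := fun y hy => by rwa [hP] at hy
  have hint : 0 ∈ interiorQ P := mem_interior 0 fun u _ => by rwa [map_zero]
  have hf0 : f ≠ 0 := by
    rintro rfl
    obtain rfl : 0 = c := hw.2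
    have hPF : P ⊆ {y ∈ P | (0 : RatSpace N →ₗ[ℚ] ℚ) y = 0} := fun y hy => ⟨hy, rfl⟩
    have htop := (vectorSpan_eq_top_of_mem_interiorQ hint).ge.trans (vectorSpan_mono ℚ hPF)
    rw [top_unique htop, finrank_top] at hdim
    omega
  have hc : 0 < c := by simpa using lt_of_mem_interiorQ hint hf0 hf
  obtain ⟨u, huU, hu⟩ : ∃ u ∈ U, l ≤ pairing u ((1 / 2 : ℚ) • (w + z)) := by
    by_contra! hlt
    have hmid := lt_of_mem_interiorQ (mem_interior _ hlt) hf0 hf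
    simp only [map_smul, map_add, hw.2, hz.2, smul_eq_mul] at hmid
    linarith
  simp only [map_smul, map_add, smul_eq_mul] at hu
  have huw : pairing u w = l := by linarith [hle w hw.1 u huU, hle z hz.1 u huU]
  have huz : pairing u z = l := by linarith [hle z hz.1 u huU]
  have hfu : f = (c / l) • pairing u :=
    eq_of_apply_eq_apply_eq (finrank_ratSpace_eq_two hN) hc.ne' hw.2 hz.2 hwz
      (by simp [hw.2, huw, hlq.ne']) (by simp [hz.2, huz, hlq.ne'])
  refine ⟨hl, u, hprim u huU, Set.ext fun y => and_congr_right fun _ => ?_⟩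
  rw [hfu, LinearMap.smul_apply, smul_eq_mul, div_mul_eq_mul_div, div_eq_iff hlq.ne',
    mul_right_inj' hc.ne']

lemma isReflexive_convexHull_of_eq {S : Set N} (hS : S.Finite) (hSprim : ∀ x ∈ S, IsPrimitive x)
    {U : Set (Module.Dual ℤ N)} (hU : U.Finite) (hUprim : ∀ u ∈ U, IsPrimitive u) {l : ℕ}
    (hl : 0 < l) (h : convexHull ℚ (toRat '' S) = {y | ∀ u ∈ U, pairing u y ≤ l}) :
    IsReflexive l (convexHull ℚ (toRat '' S)) := by
  have hvert : vertices (convexHull ℚ (toRat '' S)) ⊆ toRat '' S := extremePoints_convexHull_subset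
  have hint : (0 : RatSpace N) ∈ interiorQ (convexHull ℚ (toRat '' S)) := h ▸
    mem_interiorQ_of_forall_pairing_lt hU fun u _ => by rw [map_zero]; exact_mod_cast hl
  refine ⟨hl, ⟨⟨(hS.image toRat).toFinset, by rw [Set.Finite.coe_toFinset]⟩, ?_, ?_⟩, hint,
    fun x hx => ?_, ?_⟩
  · rw [AffineSubspace.affineSpan_eq_top_iff_vectorSpan_eq_top_of_nonempty _ _ _
      ⟨0, interiorQ_subset hint⟩, vectorSpan_eq_top_of_mem_interiorQ hint]
  · exact hvert.trans (Set.image_subset_range _ _)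
  · exact hSprim x (toRat_injective.mem_set_image.1 (hvert hx))
  · exact fun F hF => hasLocalIndex_of_isFacet hN hU hUprim hl h hF

end Facets

section Edges

variable {N : Type*} [AddCommGroup N] {l : ℕ} {P : Set (RatSpace N)}

/-- `u` is the primitive outer normal of an edge of the `l`-reflexive polygon `P`, and `n`, `m` are
the two end points of that edge, in either order. -/
structure IsEdge (P : Set (RatSpace N)) (l : ℕ) (u : Module.Dual ℤ N) (n m : N) : Prop where
  primitive : IsPrimitive u
  le : ∀ y ∈ P, pairing u y ≤ l
  left_mem : toRat n ∈ vertices P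
  right_mem : toRat m ∈ vertices P
  left_eq : u n = l
  right_eq : u m = l
  ne : n ≠ m

lemma IsEdge.symm {u : Module.Dual ℤ N} {n m : N} (h : IsEdge P l u n m) : IsEdge P l u m n :=
  ⟨h.primitive, h.le, h.right_mem, h.left_mem, h.right_eq, h.left_eq, h.ne.symm⟩

lemma IsEdge.pairing_ne_zero (hl : l ≠ 0) {u : Module.Dual ℤ N} {n m : N}
    (he : IsEdge P l u n m) : pairing u ≠ 0 := fun h => by
  simpa [he.left_eq, hl] using LinearMap.congr_fun h (toRat n)

lemma IsEdge.exists_toRat_eq_add [Module.Free ℤ N] (hN : Module.finrank ℤ N = 2) (hl : l ≠ 0)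
    {u : Module.Dual ℤ N} {n m : N} (he : IsEdge P l u n m) (y : N) :
    ∃ a b : ℚ, toRat y = a • toRat n + b • toRat m ∧ (u y : ℚ) = (a + b) * l := by
  obtain ⟨a, b, hy⟩ := exists_eq_smul_add_smul (finrank_ratSpace_eq_two hN)
    (f := pairing u) (c := l) (by exact_mod_cast hl) (by simp [he.left_eq]) (by simp [he.right_eq])
    (toRat_injective.ne he.ne) (toRat y)
  exact ⟨a, b, hy, by simpa [he.left_eq, he.right_eq, add_mul] using congrArg (pairing u) hy⟩

lemma IsLatticePolytope.convexHull_vertices (hP : IsLatticePolytope P) :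
    convexHull ℚ (vertices P) = P := by
  obtain ⟨S, rfl⟩ := hP.polytope
  exact convexHull_extremePoints_convexHull S.finite_toSet

lemma IsLatticePolytope.finite_vertices (hP : IsLatticePolytope P) : (vertices P).Finite := by
  obtain ⟨S, rfl⟩ := hP.polytope
  exact S.finite_toSet.subset extremePoints_convexHull_subset

lemma IsLatticePolytope.le_of_forall_vertices_le (hP : IsLatticePolytope P)
    {f : RatSpace N →ₗ[ℚ] ℚ} {c : ℚ} (hf : ∀ v ∈ vertices P, f v ≤ c) {y : RatSpace N}
    (hy : y ∈ P) : f y ≤ c :=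
  le_of_mem_convexHull hf (hP.convexHull_vertices.symm ▸ hy)

variable (hP : IsReflexive l P)

include hP

lemma IsReflexive.zero_mem : (0 : RatSpace N) ∈ P := interiorQ_subset hP.zero_mem_interior

lemma IsReflexive.convex : Convex ℚ P :=
  hP.latticePolytope.convexHull_vertices ▸ convex_convexHull ℚ _

lemma IsReflexive.exists_vertex_pos {f : RatSpace N →ₗ[ℚ] ℚ} (hf : f ≠ 0) :
    ∃ v ∈ vertices P, 0 < f v := by
  by_contra! hle
  simpa using lt_of_mem_interiorQ hP.zero_mem_interior hf
    fun y hy => hP.latticePolytope.le_of_forall_vertices_le hle hy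

lemma IsReflexive.exists_forall_isEdge_apply_le (y : N) :
    ∃ c : ℤ, ∀ u n m, IsEdge P l u n m → u y ≤ c := by
  obtain ⟨t, ht, hmem⟩ := exists_pos_add_smul_mem_of_mem_interiorQ hP.zero_mem_interior (toRat y)
  refine ⟨⌈l / t⌉, fun u n m he => Int.cast_le.1 (le_trans ?_ (Int.le_ceil (l / t)))⟩
  rw [le_div_iff₀ ht, mul_comm]
  simpa using he.le _ hmem

variable [Module.Free ℤ N] (hN : Module.finrank ℤ N = 2)

include hN

lemma IsReflexive.exists_isEdge_of_le {f : RatSpace N →ₗ[ℚ] ℚ} (hf : ∀ v ∈ vertices P, f v ≤ l)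
    {n m : N} (hn : toRat n ∈ vertices P) (hm : toRat m ∈ vertices P) (hfn : f (toRat n) = l)
    (hfm : f (toRat m) = l) (hnm : n ≠ m) :
    ∃ u : Module.Dual ℤ N, pairing u = f ∧ IsEdge P l u n m := by
  have hlq : (l : ℚ) ≠ 0 := by exact_mod_cast hP.index_pos.ne'
  have hle : ∀ y ∈ P, f y ≤ l := fun y hy => hP.latticePolytope.le_of_forall_vertices_le hf hy
  have hnm' : toRat n ≠ toRat m := toRat_injective.ne hnm
  obtain ⟨-, u, hu, heq⟩ := hP.localIndex _ (isFacet_sep_eq hN hlq hle hn.1 hm.1 hfn hfm hnm')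
  have hun : pairing u (toRat n) = l := (Set.ext_iff.1 heq _).1 ⟨hn.1, hfn⟩ |>.2
  have hum : pairing u (toRat m) = l := (Set.ext_iff.1 heq _).1 ⟨hm.1, hfm⟩ |>.2
  have huf : pairing u = f := eq_of_apply_eq_apply_eq (finrank_ratSpace_eq_two hN) hlq hun hum hnm'
    (hun.trans hfn.symm) (hum.trans hfm.symm)
  exact ⟨u, huf, hu, fun y hy => huf ▸ hle y hy, hn, hm,
    by exact_mod_cast pairing_toRat u n ▸ hun, by exact_mod_cast pairing_toRat u m ▸ hum, hnm⟩

lemma IsReflexive.exists_isEdge_rotate {f h : RatSpace N →ₗ[ℚ] ℚ} (hf : ∀ v ∈ vertices P, f v ≤ l)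
    {n : N} (hn : toRat n ∈ vertices P) (hfn : f (toRat n) = l) (h0 : h ≠ 0)
    (hhn : h (toRat n) = 0) (hfh : ∀ v ∈ vertices P, f v = l → h v ≤ 0) :
    ∃ (u : Module.Dual ℤ N) (m : N) (t : ℚ), 0 < t ∧ pairing u = f + t • h ∧ IsEdge P l u n m := by
  obtain ⟨t, ht, hle, v, hv, hhv, hfv⟩ := exists_pos_forall_add_mul_le
    hP.latticePolytope.finite_vertices hf hfh (hP.exists_vertex_pos h0)
  obtain ⟨m, rfl⟩ := hP.latticePolytope.vertices_subset hv
  obtain ⟨u, hu, hedge⟩ := hP.exists_isEdge_of_le hN (f := f + t • h) hle hn hv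
    (by simp [hfn, hhn]) hfv fun hnm => by simp [← hnm, hhn] at hhv
  exact ⟨u, m, t, ht, hu, hedge⟩

lemma IsReflexive.exists_isEdge : ∃ (u : Module.Dual ℤ N) (n m : N), IsEdge P l u n m := by
  have hlq : (0 : ℚ) < l := by exact_mod_cast hP.index_pos
  have hdim : 1 < Module.finrank ℚ (RatSpace N) := by simp [finrank_ratSpace_eq_two hN]
  obtain ⟨g, hg, -⟩ := exists_ne_zero_apply_eq_zero hdim 0
  obtain ⟨v, hv, hgv⟩ := hP.exists_vertex_pos hg
  obtain ⟨w, hw, hmax⟩ := Set.exists_max_image _ g hP.latticePolytope.finite_vertices ⟨v, hv⟩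
  obtain ⟨n, rfl⟩ := hP.latticePolytope.vertices_subset hw
  have hgn : 0 < g (toRat n) := hgv.trans_le (hmax v hv)
  have hfn : ((l / g (toRat n)) • g) (toRat n) = l := by simp [hgn.ne']
  have hf : ∀ y ∈ vertices P, ((l / g (toRat n)) • g) y ≤ l := fun y hy => by
    rw [LinearMap.smul_apply, smul_eq_mul, div_mul_eq_mul_div, div_le_iff₀ hgn]
    gcongr
    exact hmax y hy
  generalize (l / g (toRat n)) • g = f at hfn hf
  by_cases honly : ∀ y ∈ vertices P, f y = l → y = toRat n
  · obtain ⟨h, h0, hhn⟩ := exists_ne_zero_apply_eq_zero hdim (toRat n)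
    obtain ⟨u, m, -, -, -, hedge⟩ := hP.exists_isEdge_rotate hN hf hw hfn h0 hhn
      fun y hy hfy => (honly y hy hfy ▸ hhn).le
    exact ⟨u, n, m, hedge⟩
  · push Not at honly
    obtain ⟨y, hy, hfy, hne⟩ := honly
    obtain ⟨m, rfl⟩ := hP.latticePolytope.vertices_subset hy
    obtain ⟨u, -, hedge⟩ := hP.exists_isEdge_of_le hN hf hw hy hfn hfy fun h => hne (h ▸ rfl)
    exact ⟨u, n, m, hedge⟩

lemma IsEdge.exists_adjacent {u : Module.Dual ℤ N} {n m : N} (he : IsEdge P l u n m) :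
    ∃ (u' : Module.Dual ℤ N) (k : N), IsEdge P l u' n k ∧ u' m < l := by
  have hlq : (l : ℚ) ≠ 0 := by exact_mod_cast hP.index_pos.ne'
  have hun : pairing u (toRat n) = l := by simp [he.left_eq]
  have hum : pairing u (toRat m) = l := by simp [he.right_eq]
  have hnm : toRat n ≠ toRat m := toRat_injective.ne he.ne
  obtain ⟨h, h0, hhn, hhm⟩ : ∃ h : RatSpace N →ₗ[ℚ] ℚ, h ≠ 0 ∧ h (toRat n) = 0 ∧
      h (toRat m) < 0 := by
    obtain ⟨h, h0, hhn⟩ := exists_ne_zero_apply_eq_zero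
      (by rw [finrank_ratSpace_eq_two hN]; norm_num) (toRat n)
    have hhm : h (toRat m) ≠ 0 := fun hhm => h0 <|
      eq_of_apply_eq_apply_eq (finrank_ratSpace_eq_two hN) hlq hun hum hnm (by simp [hhn])
        (by simp [hhm])
    rcases hhm.lt_or_gt with hneg | hpos
    · exact ⟨h, h0, hhn, hneg⟩
    · exact ⟨-h, neg_ne_zero.2 h0, by simp [hhn], by simpa using hpos⟩
  have hfh : ∀ v ∈ vertices P, pairing u v = l → h v ≤ 0 := by
    intro v hv huv
    obtain ⟨a, b, rfl⟩ := exists_eq_smul_add_smul (finrank_ratSpace_eq_two hN) hlq hun hum hnm v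
    have hab : a + b = 1 := mul_right_cancel₀ hlq <| by
      simpa [hun, hum, add_mul] using huv
    have hb := nonneg_of_mem_extremePoints he.left_mem he.right_mem.1 hnm hab hv.1
    simpa [hhn] using mul_nonpos_of_nonneg_of_nonpos hb hhm.le
  obtain ⟨u', k, t, ht, hu', hedge⟩ := hP.exists_isEdge_rotate hN
    (fun v hv => he.le v hv.1) he.left_mem hun h0 hhn hfh
  refine ⟨u', k, hedge, ?_⟩
  have hval : (u' m : ℚ) = l + t * h (toRat m) := by
    rw [← pairing_toRat, hu', LinearMap.add_apply, LinearMap.smul_apply, hum, smul_eq_mul]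
  have := mul_neg_of_pos_of_neg ht hhm
  exact_mod_cast (by linarith : (u' m : ℚ) < l)

variable [Module.Finite ℤ N]

lemma IsEdge.dvd_apply_iff {u u' : Module.Dual ℤ N} {n m k : N} (he : IsEdge P l u n m)
    (he' : IsEdge P l u' n k) (y : N) : (l : ℤ) ∣ u y ↔ (l : ℤ) ∣ u' y :=
  (hP.vertices_primitive n he.left_mem).dvd_apply_iff_dvd_apply hN he.primitive he'.primitive
    he.left_eq.symm.dvd he'.left_eq.symm.dvd y

lemma IsEdge.exists_mem_cone {u₀ : Module.Dual ℤ N} {n₀ m₀ : N} (he₀ : IsEdge P l u₀ n₀ m₀)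
    (y : N) : ∃ (u : Module.Dual ℤ N) (n m : N), IsEdge P l u n m ∧
      (∀ z, (l : ℤ) ∣ u z ↔ (l : ℤ) ∣ u₀ z) ∧ ∃ a b : ℚ, 0 ≤ a ∧ 0 ≤ b ∧
        toRat y = a • toRat n + b • toRat m ∧ (u y : ℚ) = (a + b) * l := by
  -- Among the edges in the residue class of `u₀`, one of maximal height over `y` has `y` in its
  -- cone: otherwise passing to an adjacent edge would increase the height.
  obtain ⟨c, hc⟩ := hP.exists_forall_isEdge_apply_le y
  obtain ⟨_, ⟨u, n, m, he, hdvd, rfl⟩, hmax⟩ := Int.exists_greatest_of_bdd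
    (P := fun d => ∃ u n m, IsEdge P l u n m ∧ (∀ z, (l : ℤ) ∣ u z ↔ (l : ℤ) ∣ u₀ z) ∧ u y = d)
    ⟨c, by rintro _ ⟨u, n, m, he, -, rfl⟩; exact hc u n m he⟩
    ⟨_, u₀, n₀, m₀, he₀, fun _ => Iff.rfl, rfl⟩
  have nonneg : ∀ {n m : N} {a b : ℚ}, IsEdge P l u n m → toRat y = a • toRat n + b • toRat m →
      (u y : ℚ) = (a + b) * l → 0 ≤ b := by
    intro n m a b he hy huy
    obtain ⟨u', k, he', hlt⟩ := he.exists_adjacent hP hN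
    have hle : (u' y : ℚ) ≤ u y := Int.cast_le.2 <| hmax _
      ⟨u', n, k, he', fun z => (he.dvd_apply_iff hP hN he' z).symm.trans (hdvd z), rfl⟩
    have hu'y : (u' y : ℚ) = a * l + b * u' m := by
      simpa [he'.left_eq] using congrArg (pairing u') hy
    have hlt' : (u' m : ℚ) < l := by exact_mod_cast hlt
    nlinarith
  obtain ⟨a, b, hy, huy⟩ := he.exists_toRat_eq_add hN hP.index_pos.ne' y
  exact ⟨u, n, m, he, hdvd, a, b, nonneg he.symm (hy.trans (add_comm _ _))
    (huy.trans (by rw [add_comm a])), nonneg he hy huy, hy, huy⟩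

lemma IsEdge.dvd_apply_of_mem_vertices {u₀ : Module.Dual ℤ N} {n₀ m₀ : N}
    (he₀ : IsEdge P l u₀ n₀ m₀) {v : N} (hv : toRat v ∈ vertices P) : (l : ℤ) ∣ u₀ v := by
  obtain ⟨u, n, m, he, hdvd, a, b, ha, hb, hvab, huv⟩ := he₀.exists_mem_cone hP hN v
  have hv0 : toRat v ≠ 0 := fun h => (hP.vertices_primitive v hv).1 <|
    toRat_injective (h.trans toRat_zero.symm)
  have hab : 0 < a + b := add_pos_of_smul_add_smul_ne_zero ha hb (hvab ▸ hv0)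
  have hmem : (a + b)⁻¹ • toRat v ∈ P := by
    rw [hvab, smul_add, smul_smul, smul_smul]
    exact hP.convex he.left_mem.1 he.right_mem.1 (by positivity) (by positivity) (by field_simp)
  have hge : 1 ≤ a + b := (inv_le_one₀ hab).1 <|
    le_one_of_smul_mem_of_mem_extremePoints hP.zero_mem hv hv0 hmem
  have hle : (u v : ℚ) ≤ l := by simpa using he.le _ hv.1
  have huvl : (u v : ℚ) = l :=
    hle.antisymm (huv ▸ le_mul_of_one_le_left (Nat.cast_nonneg l) hge)
  exact (hdvd v).1 (Eq.dvd (by exact_mod_cast huvl.symm))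

lemma IsReflexive.exists_isEdge_pos {x : N} (hx : x ≠ 0) :
    ∃ u n m, IsEdge P l u n m ∧ 0 < u x := by
  obtain ⟨u₀, n₀, m₀, he₀⟩ := hP.exists_isEdge hN
  obtain ⟨u, n, m, he, -, a, b, ha, hb, hxab, hux⟩ := he₀.exists_mem_cone hP hN x
  refine ⟨u, n, m, he, ?_⟩
  have hx0 : toRat x ≠ 0 := fun h => hx (toRat_injective (h.trans toRat_zero.symm))
  have hab : 0 < a + b := add_pos_of_smul_add_smul_ne_zero ha hb (hxab ▸ hx0)
  have hlq : (0 : ℚ) < l := by exact_mod_cast hP.index_pos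
  have : (0 : ℚ) < u x := hux ▸ mul_pos hab hlq
  exact_mod_cast this

lemma IsEdge.apply_neg_of_adjacent (hl : l ≠ 1) {u u' : Module.Dual ℤ N} {n m k x : N}
    (he : IsEdge P l u n m) (he' : IsEdge P l u' n k) (hm : u' m < l) (hux : u x = 1)
    (hu'x : u' x ≤ 1) : u' x < 0 := by
  have hlz : ¬ IsUnit (l : ℤ) := by rwa [Int.ofNat_isUnit, Nat.isUnit_iff]
  have hne0 : u' x ≠ 0 := fun h => hlz <| isUnit_iff_dvd_one.2 <|
    hux ▸ (he.dvd_apply_iff hP hN he' x).2 (h ▸ dvd_zero _)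
  have hne1 : u' x ≠ 1 := by
    intro h
    obtain ⟨a, b, hab, hu⟩ := he.exists_toRat_eq_add hN hP.index_pos.ne' ((l : ℤ) • x - n)
    have hsum : (a + b) * l = 0 := by rw [← hu]; simp [hux, he.left_eq]
    have hlq : (l : ℚ) ≠ 0 := by exact_mod_cast hP.index_pos.ne'
    have hmq : (u' m : ℚ) < l := by exact_mod_cast hm
    have hu' : 0 = a * l + b * u' m := by
      simpa [h, he'.left_eq] using congrArg (pairing u') hab
    obtain rfl : b = -a := by linear_combination (mul_eq_zero.1 hsum).resolve_right hlq
    obtain rfl : a = 0 := by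
      have : a * (l - u' m) = 0 := by linear_combination -hu'
      exact (mul_eq_zero.1 this).resolve_right (sub_ne_zero.2 hmq.ne')
    have hnx : n = (l : ℤ) • x := (sub_eq_zero.1 <| toRat_injective <| by simpa using hab).symm
    exact hlz ((hP.vertices_primitive n he.left_mem).isUnit_of_eq_zsmul hnx)
  omega

lemma IsEdge.nonpos_of_apply_lt {u u' : Module.Dual ℤ N} {n m k z : N}
    (he : IsEdge P l u n m) (he' : IsEdge P l u' n k) (hm : u' m < l) (huz : u z = 0)
    (hu'z : u' z < l) {a : ℚ} (hz : toRat z = a • (toRat n - toRat m)) : a ≤ 0 := by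
  have hdvd : (l : ℤ) ∣ u' z := (he.dvd_apply_iff hP hN he' z).1 (huz ▸ dvd_zero _)
  have hnonpos : (u' z : ℚ) ≤ 0 := by
    exact_mod_cast not_lt.1 fun hpos => (Int.le_of_dvd hpos hdvd).not_gt hu'z
  have hval : (u' z : ℚ) = a * (l - u' m) := by
    simpa [he'.left_eq] using congrArg (pairing u') hz
  have hmq : (u' m : ℚ) < l := by exact_mod_cast hm
  exact nonpos_of_mul_nonpos_left (hval ▸ hnonpos) (sub_pos.2 hmq)

lemma IsEdge.nonpos_of_forall_apply_le_one (hl : l ≠ 1) {u : Module.Dual ℤ N} {n m x y : N}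
    (he : IsEdge P l u n m) (hx : ∀ u' n' m', IsEdge P l u' n' m' → u' x ≤ 1) (hux : u x = 1)
    (hy : toRat y ∈ vertices P) (huy : u y < 0) {a : ℚ}
    (hyx : toRat (y - u y • x) = a • (toRat n - toRat m)) : a ≤ 0 := by
  obtain ⟨u', k, he', hm⟩ := he.exists_adjacent hP hN
  have hu'x := he.apply_neg_of_adjacent hP hN hl he' hm hux (hx _ _ _ he')
  have hu'y : u' y ≤ l := by
    have := he'.le _ hy.1
    rw [pairing_toRat] at this
    exact_mod_cast this
  refine he.nonpos_of_apply_lt hP hN he' hm (by simp [hux]) ?_ hyx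
  rw [map_sub, map_smul, smul_eq_mul]
  linarith [mul_pos_of_neg_of_neg huy hu'x]

lemma IsReflexive.exists_isEdge_two_le (hl : l ≠ 1) {x : N} (hx : x ≠ 0) :
    ∃ u n m, IsEdge P l u n m ∧ 2 ≤ u x := by
  by_contra! hlt
  have hle : ∀ u n m, IsEdge P l u n m → u x ≤ 1 := fun u n m he =>
    Int.lt_add_one_iff.1 (hlt u n m he)
  obtain ⟨u, n, m, he, hpos⟩ := hP.exists_isEdge_pos hN hx
  have hux : u x = 1 := by linarith [hle u n m he]
  obtain ⟨_, hv, hneg⟩ := hP.exists_vertex_pos (f := -pairing u) <|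
    neg_ne_zero.2 (he.pairing_ne_zero hP.index_pos.ne')
  obtain ⟨y, rfl⟩ := hP.latticePolytope.vertices_subset hv
  have huy : u y < 0 := by
    rw [LinearMap.neg_apply, pairing_toRat, Left.neg_pos_iff] at hneg
    exact_mod_cast hneg
  obtain ⟨a, b, hyx, hsum⟩ := he.exists_toRat_eq_add hN hP.index_pos.ne' (y - u y • x)
  have hlq : (l : ℚ) ≠ 0 := by exact_mod_cast hP.index_pos.ne'
  obtain rfl : b = -a := by
    have : (a + b) * l = 0 := by rw [← hsum]; simp [hux]
    linear_combination (mul_eq_zero.1 this).resolve_right hlq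
  have ha : a ≤ 0 := he.nonpos_of_forall_apply_le_one hP hN hl hle hux hv huy
    (by rw [hyx]; module)
  have ha' : -a ≤ 0 := he.symm.nonpos_of_forall_apply_le_one hP hN hl hle hux hv huy
    (by rw [hyx]; module)
  obtain rfl : a = 0 := by linarith
  have hy : y = u y • x := sub_eq_zero.1 <| toRat_injective <| by simpa using hyx
  have hunit := isUnit_of_dvd_unit (he.dvd_apply_of_mem_vertices hP hN hv)
    ((hP.vertices_primitive y hv).isUnit_of_eq_zsmul hy)
  rw [Int.ofNat_isUnit, Nat.isUnit_iff] at hunit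
  exact hl hunit

lemma IsReflexive.exists_isEdge_le_mul {k : ℕ} (hk : l ≤ 2 * k) {x : N} (hx : x ≠ 0) :
    ∃ u n m, IsEdge P l u n m ∧ (l : ℤ) ≤ k * u x := by
  by_cases hl : l = 1
  · obtain ⟨u, n, m, he, hux⟩ := hP.exists_isEdge_pos hN hx
    exact ⟨u, n, m, he, by nlinarith⟩
  · obtain ⟨u, n, m, he, hux⟩ := hP.exists_isEdge_two_le hN hl hx
    exact ⟨u, n, m, he, by nlinarith⟩

lemma IsReflexive.mem_orderSet {k : ℕ} (hk : l ≤ 2 * k) : k ∈ orderSet P := by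
  have hk0 : 0 < k := by have := hP.index_pos; omega
  have hkq : (k : ℚ) ≠ 0 := by exact_mod_cast hk0.ne'
  refine ⟨hk0, Set.eq_singleton_iff_unique_mem.2 ⟨⟨?_, 0, toRat_zero⟩, ?_⟩⟩
  · rw [interiorQ_smul (inv_ne_zero hkq), Set.mem_inv_smul_set_iff₀ hkq, smul_zero]
    exact hP.zero_mem_interior
  rintro _ ⟨hx, x, rfl⟩
  rw [interiorQ_smul (inv_ne_zero hkq), Set.mem_inv_smul_set_iff₀ hkq] at hx
  by_contra hx0
  obtain ⟨u, n, m, he, hle⟩ := hP.exists_isEdge_le_mul hN hk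
    (x := x) (by rintro rfl; exact hx0 toRat_zero)
  have hlt : (k * u x : ℚ) < l := by
    simpa using lt_of_mem_interiorQ hx (he.pairing_ne_zero hP.index_pos.ne') he.le
  exact hle.not_gt (by exact_mod_cast hlt)

lemma IsReflexive.orderSet_nonempty : (orderSet P).Nonempty :=
  ⟨l, hP.mem_orderSet hN (by omega)⟩

lemma IsReflexive.two_mul_order_le : 2 * order P ≤ l + 1 := by
  have hle : order P ≤ (l + 1) / 2 := Nat.sInf_le (hP.mem_orderSet hN (by omega))
  omega

end Edges

section Hexagon

/-- The integral linear form `(x, y) ↦ a x + b y` on `ℤ²`. -/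
def form (a b : ℤ) : Module.Dual ℤ (Fin 2 → ℤ) := a • LinearMap.proj 0 + b • LinearMap.proj 1

@[simp]
lemma form_apply (a b : ℤ) (x : Fin 2 → ℤ) : form a b x = a * x 0 + b * x 1 := by
  simp [form]

lemma isPrimitive_form {a b : ℤ} (h : IsCoprime a b) : IsPrimitive (form a b) := by
  obtain ⟨c, d, hcd⟩ := h
  exact isPrimitive_of_apply_eq_one (Module.Dual.eval ℤ _ ![c, d])
    (by simpa [mul_comm] using hcd)

lemma isPrimitive_of_isCoprime {x : Fin 2 → ℤ} (h : IsCoprime (x 0) (x 1)) : IsPrimitive x := by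
  obtain ⟨c, d, hcd⟩ := h
  exact isPrimitive_of_apply_eq_one (form c d) (by simpa using hcd)

lemma eq_pairing_form_smul_add (y : RatSpace (Fin 2 → ℤ)) :
    y = pairing (form 1 0) y • toRat ![1, 0] + pairing (form 0 1) y • toRat ![0, 1] := by
  induction y using TensorProduct.induction_on with
  | zero => simp
  | tmul c x =>
    have hx : toRat x = (x 0 : ℚ) • toRat ![1, 0] + (x 1 : ℚ) • toRat ![0, 1] := by
      rw [← toRat_zsmul, ← toRat_zsmul, ← toRat_add]
      congr 1
      ext i
      fin_cases i <;> simp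
    have hc : c ⊗ₜ[ℤ] x = c • toRat x := by simp [toRat, TensorProduct.smul_tmul']
    rw [hc, map_smul, map_smul, pairing_toRat, pairing_toRat, hx]
    simp [smul_smul]
  | add y z hy hz =>
    conv_lhs => rw [hy, hz]
    simp only [map_add]
    module

lemma pairing_form (a b : ℤ) (y : RatSpace (Fin 2 → ℤ)) :
    pairing (form a b) y = a * pairing (form 1 0) y + b * pairing (form 0 1) y := by
  conv_lhs => rw [eq_pairing_form_smul_add y]
  simp [mul_comm]

lemma ext_pairing_form {y z : RatSpace (Fin 2 → ℤ)}
    (h₀ : pairing (form 1 0) y = pairing (form 1 0) z)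
    (h₁ : pairing (form 0 1) y = pairing (form 0 1) z) : y = z := by
  rw [eq_pairing_form_smul_add y, eq_pairing_form_smul_add z, h₀, h₁]

/-- The six lattice points spanning `hexagon l`, which turn out to be its vertices. -/
def hexagonVertices (l : ℕ) : Set (Fin 2 → ℤ) :=
  {![0, 1], ![0, -1], ![(l : ℤ), 2], ![-(l : ℤ), -2], ![(l : ℤ), 1], ![-(l : ℤ), -1]}

/-- The outer normals of the edges of `hexagon l`, primitive when `l` is odd. -/
def hexagonNormals (l : ℕ) : Set (Module.Dual ℤ (Fin 2 → ℤ)) :=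
  {form 1 0, form (-1) 0, form 1 (-l), form (-1) l, form 2 (-l), form (-2) l}

variable {l : ℕ}

lemma apply_le_of_mem_hexagonNormals {u : Module.Dual ℤ (Fin 2 → ℤ)} (hu : u ∈ hexagonNormals l)
    {x : Fin 2 → ℤ} (hx : x ∈ hexagonVertices l) : u x ≤ l := by
  simp only [hexagonNormals, Set.mem_insert_iff, Set.mem_singleton_iff] at hu
  simp only [hexagonVertices, Set.mem_insert_iff, Set.mem_singleton_iff] at hx
  rcases hu with rfl | rfl | rfl | rfl | rfl | rfl <;>
    rcases hx with rfl | rfl | rfl | rfl | rfl | rfl <;> simp <;> linarith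

lemma mem_hexagon_of_forall_pairing_le (hl : 0 < l) {y : RatSpace (Fin 2 → ℤ)}
    (hy : ∀ u ∈ hexagonNormals l, pairing u y ≤ l) : y ∈ hexagon l := by
  have hlq : (0 : ℚ) < l := by exact_mod_cast hl
  have hconv : Convex ℚ (hexagon l) := convex_convexHull ℚ _
  have hmem : ∀ x ∈ hexagonVertices l, toRat x ∈ hexagon l := fun x hx =>
    subset_convexHull ℚ _ ⟨x, hx, rfl⟩
  simp only [hexagonVertices, Set.forall_mem_insert, Set.mem_singleton_iff, forall_eq] at hmem
  obtain ⟨hA, hA', hC, hC', hB, hB'⟩ := hmem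
  obtain ⟨p, hp⟩ : ∃ p, pairing (form 1 0) y = p := ⟨_, rfl⟩
  obtain ⟨q, hq⟩ : ∃ q, pairing (form 0 1) y = q := ⟨_, rfl⟩
  have hle : ∀ a b : ℤ, form a b ∈ hexagonNormals l → a * p + b * q ≤ l := fun a b hab => by
    rw [← hp, ← hq, ← pairing_form]
    exact hy _ hab
  have hle₁ := hle 1 0 (by simp [hexagonNormals])
  have hle₂ := hle (-1) 0 (by simp [hexagonNormals])
  have hle₃ := hle 1 (-l) (by simp [hexagonNormals])
  have hle₄ := hle (-1) l (by simp [hexagonNormals])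
  have hle₅ := hle 2 (-l) (by simp [hexagonNormals])
  have hle₆ := hle (-2) l (by simp [hexagonNormals])
  push_cast at hle₁ hle₂ hle₃ hle₄ hle₅ hle₆
  have abs_div_le_one : ∀ r : ℚ, -l ≤ r → r ≤ l → |r / l| ≤ 1 := fun r h₁ h₂ => by
    rw [abs_div, abs_of_pos hlq, div_le_one hlq, abs_le]
    exact ⟨h₁, h₂⟩
  have hsum : (l * q - p) / l + p / l = q := by field_simp; ring
  rw [show y = ((l * q - p) / l) • toRat ![0, 1] + (p / l) • toRat ![(l : ℤ), 1] from
    ext_pairing_form (by simp [hp, hlq.ne']) (by simp [hq, hsum])]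
  refine smul_add_smul_mem_of_abs_sub_le_one hconv hA ?_ hB ?_ ?_ ?_
    (abs_div_le_one _ (by linarith) (by linarith)) (abs_div_le_one _ (by linarith) (by linarith))
    (sub_div _ _ (l : ℚ) ▸ abs_div_le_one _ (by linarith) (by linarith))
  · simpa [← toRat_neg] using hA'
  · simpa [← toRat_neg] using hB'
  · simpa [← toRat_add] using hC
  · simpa [← toRat_neg, ← toRat_add] using hC'

lemma hexagon_eq (hl : 0 < l) : hexagon l = {y | ∀ u ∈ hexagonNormals l, pairing u y ≤ l} := by
  refine Set.Subset.antisymm (fun y hy u hu => le_of_mem_convexHull ?_ hy) fun y =>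
    mem_hexagon_of_forall_pairing_le hl
  rintro _ ⟨x, hx, rfl⟩
  rw [pairing_toRat]
  exact_mod_cast apply_le_of_mem_hexagonNormals hu hx

lemma isReflexive_hexagon (hl : Odd l) : IsReflexive l (hexagon l) := by
  obtain ⟨k, hk⟩ := hl
  have hkz : (l : ℤ) = 2 * k + 1 := by exact_mod_cast hk
  have hcop : IsCoprime 2 (l : ℤ) := ⟨-k, 1, by rw [hkz]; ring⟩
  refine isReflexive_convexHull_of_eq (by simp) (S := hexagonVertices l)
    (by simp [hexagonVertices]) ?_ (U := hexagonNormals l) (by simp [hexagonNormals]) ?_ (by omega)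
    (hexagon_eq (by omega))
  · simp only [hexagonVertices, Set.forall_mem_insert, Set.mem_singleton_iff, forall_eq]
    refine ⟨?_, ?_, ?_, ?_, ?_, ?_⟩ <;> refine isPrimitive_of_isCoprime ?_ <;>
      simp [hcop.symm, isCoprime_one_right, IsCoprime.neg_left_iff, IsCoprime.neg_right_iff]
  · simp only [hexagonNormals, Set.forall_mem_insert, Set.mem_singleton_iff, forall_eq]
    refine ⟨?_, ?_, ?_, ?_, ?_, ?_⟩ <;> refine isPrimitive_form ?_ <;>
      simp [hcop, isCoprime_one_left, IsCoprime.neg_left_iff, IsCoprime.neg_right_iff]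

lemma mem_vertices_hexagon (hl : 0 < l) {x : Fin 2 → ℤ} (hx : x ∈ hexagonVertices l)
    {a b c d : ℤ} (hu : form a b ∈ hexagonNormals l) (hv : form c d ∈ hexagonNormals l)
    (hux : form a b x = l) (hvx : form c d x = l) (hdet : a * d - b * c ≠ 0) :
    toRat x ∈ vertices (hexagon l) := by
  have hle := (hexagon_eq hl).le
  refine mem_extremePoints_of_forall_le (f := pairing (form a b)) (g := pairing (form c d))
    (subset_convexHull ℚ _ ⟨x, hx, rfl⟩) (fun y hy => ?_) (fun y hy => ?_) fun y h₁ h₂ => ?_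
  · simpa [hux] using hle hy _ hu
  · simpa [hvx] using hle hy _ hv
  · have hdetq : (a * d - b * c : ℚ) ≠ 0 := by exact_mod_cast hdet
    rw [pairing_form, pairing_form a b] at h₁
    rw [pairing_form, pairing_form c d] at h₂
    refine ext_pairing_form (mul_left_cancel₀ hdetq ?_) (mul_left_cancel₀ hdetq ?_)
    · linear_combination d * h₁ - b * h₂
    · linear_combination a * h₂ - c * h₁

lemma vertices_hexagon (hl : 0 < l) : vertices (hexagon l) = toRat '' hexagonVertices l := by
  refine Set.Subset.antisymm extremePoints_convexHull_subset (Set.image_subset_iff.2 ?_)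
  have mem_vertices {x : Fin 2 → ℤ} (hx : x ∈ hexagonVertices l) (a b c d : ℤ)
      (hu : form a b ∈ hexagonNormals l) (hv : form c d ∈ hexagonNormals l)
      (h : form a b x = l ∧ form c d x = l ∧ a * d - b * c ≠ 0) : toRat x ∈ vertices (hexagon l) :=
    mem_vertices_hexagon hl hx hu hv h.1 h.2.1 h.2.2
  simp only [hexagonVertices, hexagonNormals] at mem_vertices ⊢
  rintro x (rfl | rfl | rfl | rfl | rfl | rfl)
  · exact mem_vertices (by simp) (-1) l (-2) l (by simp) (by simp) (by simp; omega)
  · exact mem_vertices (by simp) 1 (-l) 2 (-l) (by simp) (by simp) (by simp; omega)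
  · exact mem_vertices (by simp) 1 0 (-1) l (by simp) (by simp) (by simp; omega)
  · exact mem_vertices (by simp) (-1) 0 1 (-l) (by simp) (by simp) (by simp; omega)
  · exact mem_vertices (by simp) 1 0 2 (-l) (by simp) (by simp) (by simp; omega)
  · exact mem_vertices (by simp) (-1) 0 (-2) l (by simp) (by simp) (by simp; omega)

lemma ncard_hexagonVertices (hl : 0 < l) : (hexagonVertices l).ncard = 6 := by
  have hlz : (l : ℤ) ≠ 0 := by exact_mod_cast hl.ne'
  have hne : (l : ℤ) ≠ -l := by omega
  have hne' : -(l : ℤ) ≠ l := hne.symm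
  rw [hexagonVertices]
  repeat rw [Set.ncard_insert_of_notMem (by simp [hl.ne', hne, hne', hlz.symm])]
  simp

lemma le_two_mul_of_mem_orderSet_hexagon {k : ℕ} (hk : k ∈ orderSet (hexagon l)) : l ≤ 2 * k := by
  by_contra! hlt
  have hkq : (k : ℚ) ≠ 0 := by exact_mod_cast hk.1.ne'
  have hint : (k : ℚ) • toRat ![1, 0] ∈ interiorQ (hexagon l) := by
    rw [hexagon_eq (by omega)]
    refine mem_interiorQ_of_forall_pairing_lt (by simp [hexagonNormals]) ?_
    have hlt' : (2 * k : ℚ) < l := by exact_mod_cast hlt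
    have hk0 : (0 : ℚ) < k := by exact_mod_cast hk.1
    simp only [hexagonNormals, Set.forall_mem_insert, Set.mem_singleton_iff, forall_eq, map_smul,
      pairing_toRat, form_apply]
    refine ⟨?_, ?_, ?_, ?_, ?_, ?_⟩ <;> simp <;> linarith
  have hmem : toRat ![1, 0] ∈ interiorQ ((k : ℚ)⁻¹ • hexagon l) ∩ latticePoints (Fin 2 → ℤ) :=
    ⟨by rwa [interiorQ_smul (inv_ne_zero hkq), Set.mem_inv_smul_set_iff₀ hkq], _, rfl⟩
  rw [hk.2, Set.mem_singleton_iff, ← toRat_zero] at hmem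
  simpa using congrFun (toRat_injective hmem) 0

lemma two_mul_order_hexagon (hl : Odd l) : 2 * order (hexagon l) = l + 1 := by
  have hP := isReflexive_hexagon hl
  have hle := hP.two_mul_order_le (by simp)
  have hge := le_two_mul_of_mem_orderSet_hexagon (Nat.sInf_mem (hP.orderSet_nonempty (by simp)))
  rw [← order] at hge
  obtain ⟨k, hk⟩ := hl
  omega

end Hexagon

end LReflexive

theorem mainTheorem12 :
    (∀ (N : Type*) [AddCommGroup N] [Module.Free ℤ N] [Module.Finite ℤ N]
        (_ : Module.finrank ℤ N = 2) (l : ℕ) (P : Set (LReflexive.RatSpace N)),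
        LReflexive.IsReflexive l P →
          (LReflexive.orderSet P).Nonempty ∧ (LReflexive.order P : ℚ) ≤ ((l : ℚ) + 1) / 2) ∧
    (∀ l : ℕ, Odd l →
        LReflexive.IsReflexive l (LReflexive.hexagon l) ∧
        (LReflexive.vertices (LReflexive.hexagon l)).ncard = 6 ∧
        (LReflexive.orderSet (LReflexive.hexagon l)).Nonempty ∧
        (LReflexive.order (LReflexive.hexagon l) : ℚ) = ((l : ℚ) + 1) / 2) := by
  refine ⟨fun N _ _ _ hN l P hP => ⟨hP.orderSet_nonempty hN, ?_⟩, fun l hl => ?_⟩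
  · rw [le_div_iff₀' two_pos]
    exact_mod_cast hP.two_mul_order_le hN
  · have hP := LReflexive.isReflexive_hexagon hl
    refine ⟨hP, ?_, hP.orderSet_nonempty (by simp), ?_⟩
    · rw [LReflexive.vertices_hexagon hl.pos,
        Set.ncard_image_of_injective _ LReflexive.toRat_injective,
        LReflexive.ncard_hexagonVertices hl.pos]
    · rw [eq_div_iff two_ne_zero, mul_comm]
      exact_mod_cast LReflexive.two_mul_order_hexagon hl
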